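/- Let $\mathbb{P}\subseteq\mathbb{R}$ be the space of irrational numbers with the subspace topology, and let $\mathcal{K}[\mathbb{P}]$ be the set of all nonempty compact nowhere dense subsets of $\mathbb{P}$ with the Pixley–Roy topology, i.e. the topology that has as a base the sets $[K,U]=\{A\in\mathcal{K}[\mathbb{P}] : K\subseteq A\subseteq U\}$, where $K\in\mathcal{K}[\mathbb{P}]$ and $U\supseteq K$ is open in $\mathbb{P}$. A space $X$ is Menger if for every sequence $(\mathcal{U}_n)_{n\in\omega}$ of open covers of $X$ there are finite subfamilies $\mathcal{V}_n\subseteq\mathcal{U}_n$ such that $\bigcup_{n\in\omega}\mathcal{V}_n$ covers $X$. For $Y\subseteq X$ and a family $\mathcal{U}$ of subsets of $X$ put $St(Y,\mathcal{U})=\bigcup\{U\in\mathcal{U}: U\cap Y\neq\emptyset\}$. A space $X$ is star Lindelöf (respectively star Menger) if for every open cover $\mathcal{U}$ of $X$ there is a Lindelöf (respectively Menger) subspace $Y\subseteq X$ with $St(Y,\mathcal{U})=X$. Assume the Continuum Hypothesis ($\aleph_1=2^{\aleph_0}$). Then $\mathcal{K}[\mathbb{P}]$ is a regular $T_1$ space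 which is star Lindelöf but not star Menger. -/

import Mathlib

/-- The underlying set of a hyperspace of `X`: a class `𝒦` of subsets of `X`. It is a type of its
own, so that it can carry the Pixley-Roy topology. -/
def PixleyRoy {X : Type*} (𝒦 : Set (Set X)) : Type _ := {A : Set X // A ∈ 𝒦}

namespace PixleyRoy

/-- The set `[K, U] = {A ∈ 𝒦 : K ⊆ A ⊆ U}`. -/
def basic {X : Type*} {𝒦 : Set (Set X)} (K : PixleyRoy 𝒦) (U : Set X) : Set (PixleyRoy 𝒦) :=
  {A | K.1 ⊆ A.1 ∧ A.1 ⊆ U}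

/-- The sets `[K, U]` with `K ∈ 𝒦` and `U` an open neighbourhood of `K`. -/
def basicSets {X : Type*} [TopologicalSpace X] (𝒦 : Set (Set X)) : Set (Set (PixleyRoy 𝒦)) :=
  {S | ∃ (K : PixleyRoy 𝒦) (U : Set X), IsOpen U ∧ K.1 ⊆ U ∧ S = basic K U}

/-- The Pixley-Roy topology on `𝒦`. -/
instance instTopologicalSpace {X : Type*} [TopologicalSpace X] (𝒦 : Set (Set X)) :
    TopologicalSpace (PixleyRoy 𝒦) :=
  TopologicalSpace.generateFrom (basicSets 𝒦)

/-- The sets `[K, U]` form a base of the Pixley-Roy topology. -/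
theorem isTopologicalBasis_basicSets {X : Type*} [TopologicalSpace X] (𝒦 : Set (Set X)) :
    TopologicalSpace.IsTopologicalBasis (basicSets 𝒦) where
  exists_subset_inter := by
    rintro _ ⟨K, U, hU, -, rfl⟩ _ ⟨L, V, hV, -, rfl⟩ A ⟨⟨hKA, hAU⟩, hLA, hAV⟩
    refine ⟨basic A (U ∩ V), ⟨A, U ∩ V, hU.inter hV, Set.subset_inter hAU hAV, rfl⟩,
      ⟨subset_rfl, Set.subset_inter hAU hAV⟩, ?_⟩
    rintro B ⟨hAB, hB⟩
    exact ⟨⟨hKA.trans hAB, hB.trans Set.inter_subset_left⟩,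
      hLA.trans hAB, hB.trans Set.inter_subset_right⟩
  sUnion_eq := Set.eq_univ_of_forall fun A =>
    ⟨basic A Set.univ, ⟨A, Set.univ, isOpen_univ, Set.subset_univ _, rfl⟩,
      subset_rfl, Set.subset_univ _⟩
  eq_generateFrom := rfl

end PixleyRoy

/-- `𝒦[X]`: the nonempty compact nowhere dense subsets of `X`, with the Pixley-Roy topology. -/
abbrev CompactNowhereDenseHyperspace (X : Type*) [TopologicalSpace X] : Type _ :=
  PixleyRoy {K : Set X | K.Nonempty ∧ IsCompact K ∧ IsNowhereDense K}

/-- `𝒰` is a cover of `X` by open sets. -/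
def IsOpenCovering {X : Type*} [TopologicalSpace X] (𝒰 : Set (Set X)) : Prop :=
  (∀ U ∈ 𝒰, IsOpen U) ∧ ⋃₀ 𝒰 = Set.univ

/-- `St(A, 𝒰) = ⋃ {U ∈ 𝒰 : U ∩ A ≠ ∅}`. -/
def starOf {X : Type*} (A : Set X) (𝒰 : Set (Set X)) : Set X :=
  ⋃₀ {U ∈ 𝒰 | (U ∩ A).Nonempty}

/-- The Menger property. -/
def MengerSpace (X : Type*) [TopologicalSpace X] : Prop :=
  ∀ 𝒰 : ℕ → Set (Set X), (∀ n, IsOpenCovering (𝒰 n)) →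
    ∃ 𝒱 : ℕ → Set (Set X), (∀ n, 𝒱 n ⊆ 𝒰 n ∧ (𝒱 n).Finite) ∧ IsOpenCovering (⋃ n, 𝒱 n)

/-- `X` is star-`P`: every open cover `𝒰` of `X` admits a subspace `Y` with property `P` such that
`St(Y, 𝒰) = X`. -/
def StarDeterminedBy.{u} (P : (Y : Type u) → TopologicalSpace Y → Prop)
    (X : Type u) [TopologicalSpace X] : Prop :=
  ∀ 𝒰 : Set (Set X), IsOpenCovering 𝒰 →
    ∃ Y : Set X, P Y inferInstance ∧ starOf Y 𝒰 = Set.univ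

/-- Star Lindelöf spaces. -/
def StarLindelofSpace (X : Type*) [TopologicalSpace X] : Prop :=
  StarDeterminedBy (fun Y _ => LindelofSpace Y) X

/-- Star Menger spaces. -/
def StarMengerSpace (X : Type*) [TopologicalSpace X] : Prop :=
  StarDeterminedBy (fun Y _ => MengerSpace Y) X

/-!
Every set `[K, U]` is closed as well as open, which gives `T₁` and regularity.

*Star Lindelöf.* Call a family of compact sets dense if it has a member between any compact set and
any neighbourhood of it. A dense family meets every nonempty set `[K, U]`, so its star with respect
to any open cover is the whole space, and it suffices to find a dense family which is Lindelöf.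
A neighbourhood assignment `K ↦ W K` on a dense family contains a countable part which is
*absorbing* (`exists_isAbsorbing`): whenever `A ⊆ V`, the compact set `A` can be enlarged inside `V`
so as to belong to some `[K, W K]` from that part. In a Polish space this can be done for countably
many absorbing sequences at once (`exists_nonemptyCompacts_of_isAbsorbing`). There are only
continuum many absorbing sequences, so under the continuum hypothesis a diagonalization of length
`ω₁` over them and over all pairs `A ⊆ V` yields a dense family such that the countable part of any
neighbourhood assignment covers all but countably many members
(`exists_dense_lindelof_family`). Being absorbing does not refer to the family under construction,
so no transfinite recursion is involved.

*Not star Menger.* For the cover by all sets `[K, X]`, a set `{x}` lies in the star of `Y` only if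
`x` belongs to a member of `Y`. Hence `Y` covers the irrationals, and if it were Menger the
irrationals would be Menger as well. They are not: there are compact sets `F n` of rationals such
that, for any prescribed rate, some irrational is within that rate of every `F n`
(`exists_compact_rational_approx`).
-/

open Set Filter Topology TopologicalSpace Metric

/-! ### Compact sets of irrational numbers -/

/-- The map `x ↦ (x, ((x - q)⁻¹)_q)` is a closed embedding of the irrationals into `ℝ × (ℚ → ℝ)`:
its range is cut out by the equations `(a - q) * b q = 1`. -/
theorem polishSpace_irrational : PolishSpace {x : ℝ // Irrational x} := by
  let f : {x : ℝ // Irrational x} → ℝ × (ℚ → ℝ) := fun x => (x.1, fun q => (x.1 - q)⁻¹)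
  have hne : ∀ (x : {x : ℝ // Irrational x}) (q : ℚ), x.1 - q ≠ 0 := fun x q =>
    sub_ne_zero.2 (x.2.ne_rat q)
  have hf : Continuous f := by
    refine continuous_subtype_val.prodMk (continuous_pi fun q => ?_)
    exact (continuous_subtype_val.sub continuous_const).inv₀ fun x => hne x q
  have hrange : range f = ⋂ q : ℚ, {z : ℝ × (ℚ → ℝ) | (z.1 - q) * z.2 q = 1} := by
    ext ⟨a, b⟩
    simp only [mem_range, mem_iInter, mem_ofPred_eq]
    constructor
    · rintro ⟨x, hx⟩ q
      simp only [f, Prod.mk.injEq] at hx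
      rw [← hx.1, ← hx.2]
      exact mul_inv_cancel₀ (hne x q)
    · intro h
      have ha : Irrational a := by
        rintro ⟨q, rfl⟩
        simpa using h q
      exact ⟨⟨a, ha⟩, Prod.ext rfl (funext fun q => (eq_inv_of_mul_eq_one_right (h q)).symm)⟩
  refine IsClosedEmbedding.polishSpace (f := f) ⟨?_, ?_⟩
  · exact IsEmbedding.of_comp hf continuous_fst IsEmbedding.subtypeVal
  · rw [hrange]
    refine isClosed_iInter fun q => isClosed_eq ?_ continuous_const
    fun_prop

/-- A compact set of irrationals is closed in `ℝ`. If it contained `O ∩ ℙ`, with `O` open and `ℙ` the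
set of irrationals, it would contain `O` by density, hence a rational unless `O = ∅`. -/
theorem isNowhereDense_of_isCompact_irrational {K : Set {x : ℝ // Irrational x}}
    (hK : IsCompact K) : IsNowhereDense K := by
  rw [IsNowhereDense, hK.isClosed.closure_eq, eq_empty_iff_forall_notMem]
  intro x hx
  obtain ⟨U, hUK, hU, hxU⟩ := mem_interior.1 hx
  obtain ⟨O, hO, rfl⟩ := isOpen_induced_iff.1 hU
  have hsub : O ⊆ Subtype.val '' K := by
    refine (dense_irrational.open_subset_closure_inter hO).trans ?_
    refine closure_minimal ?_ (hK.image continuous_subtype_val).isClosed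
    exact fun y hy => ⟨⟨y, hy.2⟩, hUK hy.1, rfl⟩
  obtain ⟨q, hq⟩ := (Rat.denseRange_cast (𝕜 := ℝ)).exists_mem_open hO ⟨x.1, hxU⟩
  obtain ⟨y, -, hy⟩ := hsub hq
  exact y.2.ne_rat q hy

/-! ### The Pixley-Roy topology -/

namespace PixleyRoy

variable {X : Type*} [TopologicalSpace X] {𝒦 : Set (Set X)}

/-- The inclusion `K ⊆ U` is not needed, since `[K, U]` is empty without it. -/
theorem isOpen_basic (K : PixleyRoy 𝒦) {U : Set X} (hU : IsOpen U) : IsOpen (basic K U) := by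
  by_cases h : K.1 ⊆ U
  · exact (isTopologicalBasis_basicSets 𝒦).isOpen ⟨K, U, hU, h, rfl⟩
  · have : basic K U = ∅ := eq_empty_of_forall_notMem fun A hA => h (hA.1.trans hA.2)
    exact this ▸ isOpen_empty

/-- A set `A` outside `[K, U]` has the neighbourhood `[A, X]` if `A ⊈ U`, and `[A, X \ {x}]` if
some `x ∈ K` is missing from `A`. -/
theorem isClosed_basic [T1Space X] (K : PixleyRoy 𝒦) (U : Set X) : IsClosed (basic K U) := by
  refine isOpen_compl_iff.1 (isOpen_iff_mem_nhds.2 fun A hA => ?_)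
  by_cases hAU : A.1 ⊆ U
  · obtain ⟨x, hxK, hxA⟩ := not_subset.1 fun h => hA ⟨h, hAU⟩
    refine mem_of_superset ((isOpen_basic A (U := {x}ᶜ) isOpen_compl_singleton).mem_nhds
      ⟨subset_rfl, subset_compl_singleton_iff.2 hxA⟩) fun B hB hBK => ?_
    exact hB.2 (hBK.1 hxK) rfl
  · exact mem_of_superset ((isOpen_basic A isOpen_univ).mem_nhds ⟨subset_rfl, subset_univ _⟩)
      fun B hB hBK => hAU (hB.1.trans hBK.2)

theorem t1Space [T1Space X] : T1Space (PixleyRoy 𝒦) := by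
  refine ⟨fun A => ?_⟩
  have : ({A} : Set (PixleyRoy 𝒦)) = basic A A.1 := by
    ext B
    exact ⟨fun h => h ▸ ⟨subset_rfl, subset_rfl⟩, fun h => Subtype.ext (h.2.antisymm h.1)⟩
  exact this ▸ isClosed_basic A A.1

theorem regularSpace [T1Space X] : RegularSpace (PixleyRoy 𝒦) := by
  refine .of_exists_mem_nhds_isClosed_subset fun A S hS => ?_
  obtain ⟨_, ⟨K, U, hU, -, rfl⟩, hA, hsub⟩ := (isTopologicalBasis_basicSets 𝒦).mem_nhds_iff.1 hS
  exact ⟨_, (isOpen_basic K hU).mem_nhds hA, isClosed_basic K U, hsub⟩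

end PixleyRoy

/-! ### Absorbing sequences -/

section Absorbing

variable {X : Type*} [TopologicalSpace X]

/-- A sequence of pairs `(Kₙ, Wₙ)`, with `Kₙ` a nonempty compact set and `Wₙ` an open set, is
absorbing if below every open `V` containing a compact `A` there is some `Kₙ` such that both
`A` and `Kₙ` lie in `Wₙ`. Then `A ∪ Kₙ` is a compact set between `A` and `V` belonging to
`[Kₙ, Wₙ]`. -/
def IsAbsorbing (p : ℕ → NonemptyCompacts X × Opens X) : Prop :=
  ∀ (A : NonemptyCompacts X) (V : Opens X), (A : Set X) ⊆ V →
    ∃ n, ((p n).1 : Set X) ⊆ V ∧ (A : Set X) ⊆ (p n).2 ∧ ((p n).1 : Set X) ⊆ (p n).2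

/-- A second countable space has countably many open sets that interpolate between compact sets
and their open neighbourhoods. -/
theorem exists_countable_interpolating_opens (X : Type*) [TopologicalSpace X]
    [SecondCountableTopology X] :
    ∃ 𝓑 : Set (Opens X), 𝓑.Countable ∧ ∀ (A : Set X) (V : Opens X), IsCompact A → A ⊆ V →
      ∃ G ∈ 𝓑, A ⊆ G ∧ G ≤ V := by
  have hb := isBasis_countableBasis X
  -- the interior is redundant for families of open sets and makes `u` total
  let u : Set (Set X) → Opens X := fun F => ⟨interior (⋃₀ F), isOpen_interior⟩
  have hu : ∀ F ⊆ countableBasis X, ((u F : Opens X) : Set X) = ⋃₀ F := fun F hF =>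
    (isOpen_sUnion fun s hs => hb.isOpen (hF hs)).interior_eq
  refine ⟨u '' {F | F.Finite ∧ F ⊆ countableBasis X},
    (countable_ofPred_finite_subset (countable_countableBasis X)).image u, fun A V hA hAV => ?_⟩
  obtain ⟨F, hF, hFfin, hAF⟩ := hA.elim_finite_subcover_image
    (b := {s | s ∈ countableBasis X ∧ s ⊆ V}) (c := id) (fun s hs => hb.isOpen hs.1) (by
      intro x hx
      obtain ⟨s, hs, hxs, hsV⟩ := hb.exists_subset_of_mem_open (hAV hx) V.isOpen
      exact mem_iUnion₂.2 ⟨s, ⟨hs, hsV⟩, hxs⟩)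
  have hFb : F ⊆ countableBasis X := fun s hs => (hF hs).1
  refine ⟨u F, ⟨F, ⟨hFfin, hFb⟩, rfl⟩, ?_, ?_⟩
  · rw [hu F hFb, sUnion_eq_biUnion]
    exact hAF
  · rw [← SetLike.coe_subset_coe, hu F hFb]
    exact sUnion_subset fun s hs => (hF hs).2

/-- If the members of `𝒴` interpolate between compact sets and their neighbourhoods, then every
assignment of neighbourhoods to the members of `𝒴` restricts to an absorbing sequence. -/
theorem exists_isAbsorbing [SecondCountableTopology X] [Nonempty X] {𝒴 : Set (NonemptyCompacts X)}
    (h𝒴 : ∀ (A : NonemptyCompacts X) (V : Opens X), (A : Set X) ⊆ V →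
      ∃ y ∈ 𝒴, (A : Set X) ⊆ y ∧ (y : Set X) ⊆ V)
    (W : NonemptyCompacts X → Opens X) (hW : ∀ y ∈ 𝒴, (y : Set X) ⊆ W y) :
    ∃ k : ℕ → NonemptyCompacts X, (∀ n, k n ∈ 𝒴) ∧ IsAbsorbing fun n => (k n, W (k n)) := by
  obtain ⟨𝓑, h𝓑, hint⟩ := exists_countable_interpolating_opens X
  obtain ⟨y₀, hy₀, -⟩ := h𝒴 (Classical.arbitrary _) ⊤ (subset_univ _)
  -- for `V` and `G` from a countable interpolating family, a member `y ⊆ V` with `G ⊆ W y` is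
  -- picked, if there is one
  have hpick : ∀ g : Opens X × Opens X, ∃ y ∈ 𝒴, (∃ y' ∈ 𝒴, (y' : Set X) ⊆ g.1 ∧ g.2 ≤ W y') →
      (y : Set X) ⊆ g.1 ∧ g.2 ≤ W y := by
    intro g
    by_cases h : ∃ y' ∈ 𝒴, (y' : Set X) ⊆ g.1 ∧ g.2 ≤ W y'
    · obtain ⟨y, hy, hyg⟩ := h
      exact ⟨y, hy, fun _ => hyg⟩
    · exact ⟨y₀, hy₀, fun h' => absurd h' h⟩
  choose c hc𝒴 hc using hpick
  have hne : (𝓑 ×ˢ 𝓑).Nonempty := by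
    obtain ⟨G, hG, -⟩ := hint ∅ ⊤ isCompact_empty (empty_subset _)
    exact ⟨(G, G), hG, hG⟩
  obtain ⟨g, hg⟩ := (h𝓑.prod h𝓑).exists_eq_range hne
  refine ⟨fun n => c (g n), fun n => hc𝒴 _, fun A V hAV => ?_⟩
  obtain ⟨V', hV', hAV', hVV'⟩ := hint A V A.isCompact hAV
  obtain ⟨y, hy, hAy, hyV'⟩ := h𝒴 A V' hAV'
  obtain ⟨G, hG, hyG, hGW⟩ := hint y (W y) y.isCompact (hW y hy)
  obtain ⟨n, hn⟩ : (V', G) ∈ range g := hg ▸ ⟨hV', hG⟩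
  have key := hc (g n) (by rw [hn]; exact ⟨y, hy, hyV', hGW⟩)
  refine ⟨n, key.1.trans ?_, (hAy.trans hyG).trans ?_, hW _ (hc𝒴 _)⟩
  · rw [hn]; exact hVV'
  · rw [hn] at key
    simpa only [hn] using SetLike.coe_subset_coe.2 key.2

end Absorbing

/-- A fusion argument: enlarge `A` successively by a term of each of the given sequences, within
smaller and smaller neighbourhoods. The intersection of these neighbourhoods is closed and totally
bounded. -/
theorem exists_nonemptyCompacts_of_isAbsorbing {X : Type*} [TopologicalSpace X]
    [IsCompletelyMetrizableSpace X] (p : ℕ → ℕ → NonemptyCompacts X × Opens X)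
    (hp : ∀ i, IsAbsorbing (p i)) (A : NonemptyCompacts X) (V : Opens X) (hAV : (A : Set X) ⊆ V) :
    ∃ B : NonemptyCompacts X, (A : Set X) ⊆ B ∧ (B : Set X) ⊆ V ∧
      ∀ i, ∃ n, ((p i n).1 : Set X) ⊆ B ∧ (B : Set X) ⊆ (p i n).2 := by
  let := upgradeIsCompletelyMetrizable X
  have step : ∀ (i : ℕ) (s : NonemptyCompacts X × {ε : ℝ // 0 < ε}),
      ∃ t : NonemptyCompacts X × {ε : ℝ // 0 < ε}, (s.1 : Set X) ⊆ t.1 ∧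
        t.2.1 ≤ 1 / ((i : ℝ) + 1) ∧
        cthickening t.2.1 (t.1 : Set X) ⊆ cthickening s.2.1 (s.1 : Set X) ∧
        ∃ n, ((p i n).1 : Set X) ⊆ t.1 ∧ cthickening t.2.1 (t.1 : Set X) ⊆ (p i n).2 := by
    rintro i ⟨C, ε, hε⟩
    let U : Opens X := ⟨thickening ε C, isOpen_thickening⟩
    have hCU : (C : Set X) ⊆ U := self_subset_thickening hε _
    obtain ⟨n, hnU, hCW, hnW⟩ := hp i C U hCU
    obtain ⟨δ, hδ, hsub⟩ := (C ⊔ (p i n).1).isCompact.exists_cthickening_subset_open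
      (U.isOpen.inter (p i n).2.isOpen)
      (by
        rw [NonemptyCompacts.coe_sup]
        exact union_subset (subset_inter hCU hCW) (subset_inter hnU hnW))
    have hpos : 0 < 1 / ((i : ℝ) + 1) := by positivity
    have hmin := (cthickening_mono (min_le_left δ (1 / ((i : ℝ) + 1)))
      ((C ⊔ (p i n).1 : NonemptyCompacts X) : Set X)).trans hsub
    refine ⟨(C ⊔ (p i n).1, ⟨min δ (1 / ((i : ℝ) + 1)), lt_min hδ hpos⟩), ?_, min_le_right _ _,
      (hmin.trans inter_subset_left).trans (thickening_subset_cthickening _ _), n, ?_,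
      hmin.trans inter_subset_right⟩
    · rw [NonemptyCompacts.coe_sup]
      exact subset_union_left
    · rw [NonemptyCompacts.coe_sup]
      exact subset_union_right
  choose f hf_sub hf_le hf_nest hf_absorb using step
  obtain ⟨ε₀, hε₀, hε₀V⟩ := A.isCompact.exists_cthickening_subset_open V.isOpen hAV
  -- `s i` is the compact set reached after `i` steps with the radius of its neighbourhood `N i`
  let s : ℕ → NonemptyCompacts X × {ε : ℝ // 0 < ε} := fun n => Nat.rec (A, ⟨ε₀, hε₀⟩) f n
  have hs : ∀ i, s (i + 1) = f i (s i) := fun i => rfl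
  let N : ℕ → Set X := fun i => cthickening (s i).2.1 ((s i).1 : Set X)
  have hmono : Monotone fun i => ((s i).1 : Set X) :=
    monotone_nat_of_le_succ fun i => by rw [hs]; exact hf_sub i (s i)
  have hanti : Antitone N := antitone_nat_of_succ_le fun i => by
    simp only [N, hs]; exact hf_nest i (s i)
  have hsN : ∀ i j, ((s i).1 : Set X) ⊆ N j := fun i j =>
    (hmono (le_max_left i j)).trans
      ((self_subset_cthickening _).trans (hanti (le_max_right i j)))
  have hsB : ∀ i, ((s i).1 : Set X) ⊆ ⋂ j, N j := fun i => subset_iInter (hsN i)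
  have hB : IsCompact (⋂ j, N j) := by
    refine TotallyBounded.isCompact_of_isClosed ?_ (isClosed_iInter fun j => isClosed_cthickening)
    refine totallyBounded_iff.2 fun ε hε => ?_
    obtain ⟨i, hi⟩ := exists_nat_one_div_lt (half_pos hε)
    obtain ⟨t, ht, hst⟩ := totallyBounded_iff.1 (s (i + 1)).1.isCompact.totallyBounded _
      (half_pos hε)
    refine ⟨t, ht, fun x hx => ?_⟩
    have hlt : (s (i + 1)).2.1 < ε / 2 := by
      rw [hs]; exact (hf_le i (s i)).trans_lt hi
    obtain ⟨z, hz, hxz⟩ := mem_thickening_iff.1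
      (cthickening_subset_thickening' (half_pos hε) hlt _ (mem_iInter.1 hx (i + 1)))
    obtain ⟨w, hw, hzw⟩ := mem_iUnion₂.1 (hst hz)
    refine mem_iUnion₂.2 ⟨w, hw, ?_⟩
    rw [mem_ball] at hzw ⊢
    linarith [dist_triangle x z w]
  refine ⟨⟨⟨_, hB⟩, A.nonempty.mono (hsB 0)⟩, hsB 0, (iInter_subset N 0).trans hε₀V, fun i => ?_⟩
  obtain ⟨n, hn, hnW⟩ := hf_absorb i (s i)
  exact ⟨n, hn.trans (hsB (i + 1)), (iInter_subset N (i + 1)).trans hnW⟩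

/-! ### A dense Lindelöf family of compact sets -/

open Cardinal in
theorem mk_setOf_borel_le_continuum (X : Type*) [TopologicalSpace X] [SecondCountableTopology X] :
    #{s : Set X | @MeasurableSet X (borel X) s} ≤ 𝔠 := by
  rw [(isBasis_countableBasis X).borel_eq_generateFrom]
  refine MeasurableSpace.cardinal_measurableSet_le_continuum ?_
  exact ((countable_countableBasis X).le_aleph0).trans aleph0_le_continuum

open Cardinal in
theorem mk_opens_le_continuum (X : Type*) [TopologicalSpace X] [SecondCountableTopology X] :
    #(Opens X) ≤ 𝔠 := by
  refine (mk_le_of_injective (f := fun U : Opens X => (⟨U, ?_⟩ :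
    {s : Set X | @MeasurableSet X (borel X) s})) ?_).trans (mk_setOf_borel_le_continuum X)
  · exact MeasurableSpace.measurableSet_generateFrom U.isOpen
  · exact fun U V h => SetLike.coe_injective (congrArg Subtype.val h)

open Cardinal in
theorem mk_nonemptyCompacts_le_continuum (X : Type*) [TopologicalSpace X] [T2Space X]
    [SecondCountableTopology X] : #(NonemptyCompacts X) ≤ 𝔠 := by
  refine (mk_le_of_injective (f := fun K : NonemptyCompacts X =>
    (⟨(K : Set X)ᶜ, K.isCompact.isClosed.isOpen_compl⟩ : Opens X)) fun K L h => ?_).trans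
    (mk_opens_le_continuum X)
  exact SetLike.coe_injective (compl_injective (congrArg (fun U : Opens X => (U : Set X)) h))

open Cardinal in
/-- A nonempty type with at most `ℵ₁` elements is exhausted by a sequence of length `ω₁`. -/
theorem exists_surjective_countable_Iic {T : Type} [Nonempty T] (hT : #T ≤ ℵ₁) :
    ∃ (I : Type) (_ : LinearOrder I) (e : I → T), Function.Surjective e ∧
      ∀ i : I, (Iic i).Countable := by
  refine ⟨(Cardinal.aleph 1).ord.ToType, inferInstance, ?_⟩
  have : #T ≤ #((Cardinal.aleph 1).ord.ToType) := by rwa [mk_ord_toType]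
  obtain ⟨g⟩ := Cardinal.le_def _ _ |>.1 this
  refine ⟨Function.invFun g, Function.invFun_surjective g.injective, fun i => ?_⟩
  rw [← Iio_insert]
  refine Countable.insert i ?_
  rw [← le_aleph0_iff_set_countable, ← Order.lt_succ_iff, succ_aleph0]
  simpa using Cardinal.mk_Iio_lt i

open Cardinal in
/-- Under the continuum hypothesis there is a dense Lindelöf family of compact sets. The `i`-th
member, `i < ω₁`, is placed between the `i`-th pair `A ⊆ V` and meets the requirement of each
absorbing sequence with index at most `i`. A neighbourhood assignment contains an absorbing
sequence, whose terms therefore take care of all but countably many members. -/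
theorem exists_dense_lindelof_family (CH : ℵ₁ = (𝔠 : Cardinal.{0})) (X : Type)
    [TopologicalSpace X] [PolishSpace X] [Nonempty X] :
    ∃ 𝒴 : Set (NonemptyCompacts X),
      (∀ (A : NonemptyCompacts X) (V : Opens X), (A : Set X) ⊆ V →
        ∃ y ∈ 𝒴, (A : Set X) ⊆ y ∧ (y : Set X) ⊆ V) ∧
      ∀ W : NonemptyCompacts X → Opens X, (∀ y ∈ 𝒴, (y : Set X) ⊆ W y) →
        ∃ C ⊆ 𝒴, C.Countable ∧ ∀ y ∈ 𝒴, ∃ c ∈ C, (c : Set X) ⊆ y ∧ (y : Set X) ⊆ W c := by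
  let T := {z : NonemptyCompacts X × Opens X // (z.1 : Set X) ⊆ z.2} ×
    {p : ℕ → NonemptyCompacts X × Opens X // IsAbsorbing p}
  have hprod : #(NonemptyCompacts X × Opens X) ≤ 𝔠 := by
    rw [mk_prod, lift_id, lift_id, ← continuum_mul_self]
    exact mul_le_mul' (mk_nonemptyCompacts_le_continuum X) (mk_opens_le_continuum X)
  have hT : #T ≤ ℵ₁ := by
    rw [CH, mk_prod, lift_id, lift_id, ← continuum_mul_self]
    refine mul_le_mul' ((mk_subtype_le _).trans hprod) ((mk_subtype_le _).trans ?_)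
    rw [← power_def, mk_nat, ← continuum_power_aleph0]
    exact power_le_power_right hprod
  have : Nonempty T := by
    obtain ⟨k, -, hk⟩ := exists_isAbsorbing (𝒴 := (univ : Set (NonemptyCompacts X)))
      (fun A V h => ⟨A, mem_univ _, subset_rfl, h⟩) (fun _ => ⊤) (fun _ _ => subset_univ _)
    exact ⟨⟨⟨(Classical.arbitrary _, ⊤), subset_univ _⟩, ⟨_, hk⟩⟩⟩
  obtain ⟨I, _, e, he, hI⟩ := exists_surjective_countable_Iic hT
  have hy : ∀ i, ∃ y : NonemptyCompacts X, ((e i).1.1.1 : Set X) ⊆ y ∧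
      (y : Set X) ⊆ (e i).1.1.2 ∧
      ∀ j ≤ i, ∃ n, (((e j).2.1 n).1 : Set X) ⊆ y ∧ (y : Set X) ⊆ ((e j).2.1 n).2 := by
    intro i
    obtain ⟨g, hg⟩ := (hI i).exists_eq_range ⟨i, mem_Iic.2 le_rfl⟩
    obtain ⟨y, hAy, hyV, hy⟩ := exists_nonemptyCompacts_of_isAbsorbing
      (fun n => (e (g n)).2.1) (fun n => (e (g n)).2.2) (e i).1.1.1 (e i).1.1.2 (e i).1.2
    refine ⟨y, hAy, hyV, fun j hj => ?_⟩
    obtain ⟨n, rfl⟩ : j ∈ range g := hg ▸ mem_Iic.2 hj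
    exact hy n
  choose y hAy hyV hy using hy
  have hdense : ∀ (A : NonemptyCompacts X) (V : Opens X), (A : Set X) ⊆ V →
      ∃ z ∈ range y, (A : Set X) ⊆ z ∧ (z : Set X) ⊆ V := by
    intro A V hAV
    -- `(A, V)` occurs in the enumeration, accompanied by an arbitrary absorbing sequence
    obtain ⟨i, hi⟩ := he (⟨(A, V), hAV⟩, (Classical.arbitrary T).2)
    refine ⟨y i, mem_range_self i, ?_, ?_⟩
    · simpa [hi] using hAy i
    · simpa [hi] using hyV i
  refine ⟨range y, hdense, fun W hW => ?_⟩
  obtain ⟨k, hk, habs⟩ := exists_isAbsorbing hdense W hW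
  obtain ⟨j, hj⟩ := he ((Classical.arbitrary T).1, ⟨_, habs⟩)
  -- the sequence `k` covers the members with index at least `j`
  refine ⟨range k ∪ y '' Iic j, ?_, (countable_range k).union ((hI j).image y), ?_⟩
  · rintro _ (⟨n, rfl⟩ | ⟨i, -, rfl⟩)
    · exact hk n
    · exact mem_range_self i
  · rintro _ ⟨i, rfl⟩
    rcases le_total i j with hij | hji
    · exact ⟨y i, Or.inr ⟨i, hij, rfl⟩, subset_rfl, hW _ (mem_range_self i)⟩
    · obtain ⟨n, hn⟩ := hy i j hji
      rw [hj] at hn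
      exact ⟨k n, Or.inl ⟨n, rfl⟩, hn⟩

/-- The subspace formed by a dense Lindelöf family witnesses the star Lindelöf property for every
open cover. -/
theorem starLindelofSpace_compactNowhereDenseHyperspace
    (CH : Cardinal.aleph 1 = (Cardinal.continuum : Cardinal.{0})) (X : Type)
    [TopologicalSpace X] [PolishSpace X] [Nonempty X]
    (hX : ∀ K : Set X, IsCompact K → IsNowhereDense K) :
    StarLindelofSpace (CompactNowhereDenseHyperspace X) := by
  obtain ⟨𝒴, hdense, hlind⟩ := exists_dense_lindelof_family CH X
  let E : NonemptyCompacts X → CompactNowhereDenseHyperspace X := fun K =>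
    ⟨K, K.nonempty, K.isCompact, hX K K.isCompact⟩
  intro 𝒰 h𝒰
  refine ⟨E '' 𝒴, isLindelof_iff_lindelofSpace.1 ?_, eq_univ_of_forall fun A => ?_⟩
  · refine isLindelof_of_countable_subcover fun {ι} U hUo hU => ?_
    have hbase : ∀ y : NonemptyCompacts X, ∃ W : Opens X, y ∈ 𝒴 →
        (y : Set X) ⊆ W ∧ ∃ j, PixleyRoy.basic (E y) W ⊆ U j := by
      intro y
      by_cases hy : y ∈ 𝒴
      · obtain ⟨j, hj⟩ := mem_iUnion.1 (hU (mem_image_of_mem E hy))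
        obtain ⟨_, ⟨K, O, hO, -, rfl⟩, hyO, hsub⟩ :=
          (PixleyRoy.isTopologicalBasis_basicSets _).mem_nhds_iff.1 ((hUo j).mem_nhds hj)
        exact ⟨⟨O, hO⟩, fun _ => ⟨hyO.2, j, fun B hB => hsub ⟨hyO.1.trans hB.1, hB.2⟩⟩⟩
      · exact ⟨⊤, fun h => absurd h hy⟩
    choose W hW using hbase
    obtain ⟨C, hC𝒴, hC, hcover⟩ := hlind W fun y hy => (hW y hy).1
    have : Countable C := hC
    choose j hj using fun c : C => (hW c (hC𝒴 c.2)).2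
    refine ⟨range j, countable_range j, ?_⟩
    rintro _ ⟨y, hy, rfl⟩
    obtain ⟨c, hc, hcy, hyW⟩ := hcover y hy
    exact mem_iUnion₂.2 ⟨j ⟨c, hc⟩, mem_range_self _, hj ⟨c, hc⟩ ⟨hcy, hyW⟩⟩
  · obtain ⟨U, hU, hAU⟩ := mem_sUnion.1 (h𝒰.2 ▸ mem_univ A)
    obtain ⟨_, ⟨K, O, hO, -, rfl⟩, hA, hsub⟩ :=
      (PixleyRoy.isTopologicalBasis_basicSets _).mem_nhds_iff.1 ((h𝒰.1 U hU).mem_nhds hAU)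
    obtain ⟨y, hy, hAy, hyO⟩ := hdense ⟨⟨A.1, A.2.2.1⟩, A.2.1⟩ ⟨O, hO⟩ hA.2
    exact ⟨U, ⟨hU, E y, hsub ⟨hA.1.trans hAy, hyO⟩, y, hy, rfl⟩, hAU⟩

/-! ### Failure of the star Menger property -/

open Pointwise in
/-- Take `F 0 = {0}` and `F (n + 1) = F n + ({0} ∪ {1 / (k + 1) : k ∈ ℕ})`. Every point of `F n` is
a limit of points of `F (n + 1)`, so nested intervals centred at points of the `F n` can be made
as short as desired and can avoid the rational numbers one by one. -/
theorem exists_compact_rational_approx :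
    ∃ F : ℕ → Set ℝ, (∀ n, IsCompact (F n)) ∧ (∀ n, ∀ y ∈ F n, ¬ Irrational y) ∧
      ∀ r : ℕ → ℝ, (∀ n, 0 < r n) →
        ∃ x, Irrational x ∧ ∀ n, ∃ y ∈ F n, dist x y ≤ r n := by
  let S : Set ℝ := insert 0 (range fun k : ℕ => 1 / ((k : ℝ) + 1))
  have hS : IsCompact S := tendsto_one_div_add_atTop_nhds_zero_nat.isCompact_insert_range
  have hSrat : ∀ y ∈ S, y ∈ range ((↑) : ℚ → ℝ) := by
    rintro _ (rfl | ⟨k, rfl⟩)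
    · exact ⟨0, by simp⟩
    · exact ⟨1 / ((k : ℚ) + 1), by simp⟩
  let F : ℕ → Set ℝ := fun n => Nat.rec {0} (fun _ G => G + S) n
  have hF : ∀ n, F (n + 1) = F n + S := fun n => rfl
  refine ⟨F, fun n => ?_, fun n y hy => ?_, fun r hr => ?_⟩
  · induction n with
    | zero => exact isCompact_singleton
    | succ n ih => exact ih.add hS
  · rw [Irrational, not_not]
    induction n generalizing y with
    | zero => exact ⟨0, by rw [mem_singleton_iff.1 hy]; simp⟩
    | succ n ih =>
      obtain ⟨a, ha, b, hb, rfl⟩ := mem_add.1 (hF n ▸ hy)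
      obtain ⟨p, rfl⟩ := ih a ha
      obtain ⟨q, rfl⟩ := hSrat b hb
      exact ⟨p + q, by simp⟩
  · obtain ⟨q, hq⟩ := exists_surjective_nat ℚ
    let P : ℕ → ℝ × ℝ → Prop := fun n s => s.1 ∈ F n ∧ 0 < s.2 ∧ s.2 ≤ r n
    have step : ∀ (n : ℕ) (s : ℝ × ℝ), P n s → ∃ t : ℝ × ℝ, P (n + 1) t ∧
        closedBall t.1 t.2 ⊆ closedBall s.1 s.2 ∧ (q n : ℝ) ∉ closedBall t.1 t.2 := by
      rintro n ⟨x, ε⟩ ⟨hx, hε, -⟩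
      obtain ⟨δ, hδ, hδε, hδq⟩ : ∃ δ > 0, δ ≤ ε ∧ ∀ u : ℝ, 0 < u → u < δ → x + u ≠ q n := by
        by_cases h : (q n : ℝ) = x
        · exact ⟨ε, hε, le_rfl, fun u hu _ he => by linarith⟩
        · refine ⟨min ε |q n - x|, lt_min hε (abs_pos.2 (sub_ne_zero.2 h)), min_le_left _ _,
            fun u hu huδ he => ?_⟩
          have := huδ.trans_le (min_le_right _ _)
          rw [← he, add_sub_cancel_left, abs_of_pos hu] at this
          exact this.false
      obtain ⟨k, hk⟩ := exists_nat_one_div_lt hδ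
      set u : ℝ := 1 / ((k : ℝ) + 1) with hu
      have hu0 : 0 < u := by positivity
      have hd : 0 < dist (q n : ℝ) (x + u) := dist_pos.2 (hδq u hu0 hk).symm
      refine ⟨(x + u, min (r (n + 1)) (min (ε - u) (dist (q n : ℝ) (x + u) / 2))),
        ⟨?_, lt_min (hr _) (lt_min (by linarith) (half_pos hd)), min_le_left _ _⟩, ?_, ?_⟩
      · exact hF n ▸ add_mem_add hx (mem_insert_of_mem _ ⟨k, rfl⟩)
      · refine closedBall_subset_closedBall' ?_
        have h1 : dist (x + u) x = u := by simp [abs_of_pos hu0]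
        have h2 := (min_le_right (r (n + 1)) _).trans
          (min_le_left (ε - u) (dist (q n : ℝ) (x + u) / 2))
        rw [h1]
        linarith
      · rw [mem_closedBall, not_le]
        have h2 := (min_le_right (r (n + 1)) _).trans
          (min_le_right (ε - u) (dist (q n : ℝ) (x + u) / 2))
        exact h2.trans_lt (half_lt_self hd)
    choose g hgP hg_nest hg_avoid using step
    let s : ∀ n, {s : ℝ × ℝ // P n s} := fun n =>
      Nat.rec ⟨(0, r 0), mem_singleton _, hr 0, le_rfl⟩ (fun n s => ⟨g n s.1 s.2, hgP n s.1 s.2⟩) n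
    have hs : ∀ n, (s (n + 1)).1 = g n (s n).1 (s n).2 := fun n => rfl
    obtain ⟨x, hx⟩ := IsCompact.nonempty_iInter_of_sequence_nonempty_isCompact_isClosed
      (fun n => closedBall (s n).1.1 (s n).1.2)
      (fun n => by simp only [hs]; exact hg_nest n _ _)
      (fun n => nonempty_closedBall.2 (s n).2.2.1.le)
      (isCompact_closedBall _ _) (fun n => isClosed_closedBall)
    rw [mem_iInter] at hx
    refine ⟨x, ?_, fun n => ⟨(s n).1.1, (s n).2.1, (mem_closedBall.1 (hx n)).trans (s n).2.2.2⟩⟩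
    rintro ⟨p, rfl⟩
    obtain ⟨n, rfl⟩ := hq p
    have := hx (n + 1)
    rw [hs] at this
    exact hg_avoid n _ _ this

/-- A family of compact sets of irrationals that covers the irrationals is not Menger: a selection
from the covers by the sets `{y | y stays 1 / (m + 1) away from F n}`, `m ∈ ℕ`, with `F n` as in
`exists_compact_rational_approx`, misses the members that contain a suitable irrational `x`. -/
theorem not_mengerSpace_of_forall_mem
    (Y : Set (CompactNowhereDenseHyperspace {x : ℝ // Irrational x}))
    (hY : ∀ x, ∃ y ∈ Y, x ∈ y.1) : ¬ MengerSpace Y := by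
  intro hM
  obtain ⟨F, hFc, hFrat, hF⟩ := exists_compact_rational_approx
  let O : ℕ → ℕ → Set {x : ℝ // Irrational x} := fun n m =>
    {x | x.1 ∉ cthickening (1 / ((m : ℝ) + 1)) (F n)}
  have hO : ∀ n m, IsOpen (O n m) := fun n m =>
    isClosed_cthickening.isOpen_compl.preimage continuous_subtype_val
  have hOmono : ∀ n, Monotone (O n) := fun n m m' hm x hx hx' =>
    hx (cthickening_mono (one_div_le_one_div_of_le (by positivity) (by simpa using hm)) _ hx')
  let G : ℕ → ℕ → Set Y := fun n m => {y | y.1.1 ⊆ O n m}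
  have hG : ∀ n m, IsOpen (G n m) := by
    intro n m
    have : G n m = Subtype.val ⁻¹' ⋃ K, PixleyRoy.basic K (O n m) := by
      ext y
      simp only [mem_preimage, mem_iUnion]
      exact ⟨fun h => ⟨y.1, subset_rfl, h⟩, fun ⟨K, hK⟩ => hK.2⟩
    rw [this]
    exact (isOpen_iUnion fun K => PixleyRoy.isOpen_basic K (hO n m)).preimage
      continuous_subtype_val
  obtain ⟨𝒱, h𝒱, h𝒱cov⟩ := hM (fun n => range (G n)) fun n => by
    refine ⟨by rintro _ ⟨m, rfl⟩; exact hG n m, eq_univ_of_forall fun y => ?_⟩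
    have hyc : IsCompact (Subtype.val '' y.1.1) := y.1.2.2.1.image continuous_subtype_val
    have hdisj : Disjoint (F n) (Subtype.val '' y.1.1) := by
      rw [Set.disjoint_left]
      rintro _ hz ⟨x, -, rfl⟩
      exact hFrat n _ hz x.2
    obtain ⟨δ, hδ, hδF⟩ := (hFc n).exists_cthickening_subset_open hyc.isClosed.isOpen_compl
      (disjoint_left.1 hdisj)
    obtain ⟨m, hm⟩ := exists_nat_one_div_lt hδ
    exact ⟨G n m, mem_range_self m, fun x hx hxF =>
      hδF (cthickening_mono hm.le _ hxF) (mem_image_of_mem _ hx)⟩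
  -- the sets `G n m` increase with `m`, so each finite selection lies in a single one
  have hbound : ∀ n, ∃ m, ∀ V ∈ 𝒱 n, V ⊆ G n m := by
    intro n
    choose! m hm using (h𝒱 n).1
    obtain ⟨M, hM⟩ := ((h𝒱 n).2.image m).bddAbove
    refine ⟨M, fun V hV => ?_⟩
    rw [← hm hV]
    exact fun y hy => hy.trans (hOmono n (hM (mem_image_of_mem m hV)))
  choose f hf using hbound
  obtain ⟨x, hx, hxF⟩ := hF (fun n => 1 / ((f n : ℝ) + 1)) fun n => by positivity
  obtain ⟨y, hyY, hxy⟩ := hY ⟨x, hx⟩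
  obtain ⟨V, hV, hyV⟩ := mem_sUnion.1 (h𝒱cov.2 ▸ mem_univ (⟨y, hyY⟩ : Y))
  obtain ⟨n, hVn⟩ := mem_iUnion.1 hV
  obtain ⟨z, hz, hxz⟩ := hxF n
  exact hf n V hVn hyV hxy (mem_cthickening_of_dist_le x z _ _ hz hxz)

/-- Let `ℙ` be the space of irrationals. In the cover of the hyperspace by the sets `[K, ℙ]`, the
only member containing a singleton `{x}` is `[{x}, ℙ]`,
so a subspace whose star is everything covers `ℙ`. -/
theorem not_starMengerSpace_irrational :
    ¬ StarMengerSpace (CompactNowhereDenseHyperspace {x : ℝ // Irrational x}) := by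
  intro h
  obtain ⟨Y, hY, hstar⟩ := h (range fun K => PixleyRoy.basic K univ)
    ⟨by rintro _ ⟨K, rfl⟩; exact PixleyRoy.isOpen_basic K isOpen_univ,
      eq_univ_of_forall fun K => ⟨_, mem_range_self K, subset_rfl, subset_univ _⟩⟩
  refine not_mengerSpace_of_forall_mem Y (fun x => ?_) hY
  let A : CompactNowhereDenseHyperspace {x : ℝ // Irrational x} :=
    ⟨{x}, singleton_nonempty x, isCompact_singleton,
      isNowhereDense_of_isCompact_irrational isCompact_singleton⟩
  obtain ⟨_, ⟨⟨K, rfl⟩, y, hy, hyY⟩, hA⟩ := mem_sUnion.1 (hstar ▸ mem_univ A)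
  -- a nonempty subset of `{x}` contains `x`
  obtain ⟨z, hz⟩ := K.2.1
  exact ⟨y, hyY, hy.1 ((hA.1 hz : z = x) ▸ hz)⟩

theorem mainTheorem1
    (CH : Cardinal.aleph 1 = (Cardinal.continuum : Cardinal.{0})) :
    T1Space (CompactNowhereDenseHyperspace {x : ℝ // Irrational x}) ∧
    RegularSpace (CompactNowhereDenseHyperspace {x : ℝ // Irrational x}) ∧
    StarLindelofSpace (CompactNowhereDenseHyperspace {x : ℝ // Irrational x}) ∧
    ¬ StarMengerSpace (CompactNowhereDenseHyperspace {x : ℝ // Irrational x}) := by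
  have := polishSpace_irrational
  have : Nonempty {x : ℝ // Irrational x} := ⟨⟨_, irrational_sqrt_two⟩⟩
  exact ⟨PixleyRoy.t1Space, PixleyRoy.regularSpace,
    starLindelofSpace_compactNowhereDenseHyperspace CH _
      fun _ => isNowhereDense_of_isCompact_irrational,
    not_starMengerSpace_irrational⟩
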